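/- Let $1\le N\le M$ be integers, let $\overline{\mathbb B}^N$ be the closed unit ball of $\mathbb R^N$ and $\mathbb S^M$ the unit sphere of $\mathbb R^{M+1}$. For $x\in\mathbb R^{M+1}$ with $|x|<1$, let $T_x$ denote the Möbius transformation of the closed unit ball of $\mathbb R^{M+1}$ given by $$T_x(y)=\frac{(1+2x\cdot y+|y|^2)\,x+(1-|x|^2)\,y}{1+2x\cdot y+|x|^2|y|^2},$$ which maps $\mathbb S^M$ to itself. Let $\omega:\overline{\mathbb B}^N\to\mathbb S^M$ be a smooth embedding (smooth up to the boundary, injective, with injective differential at every point of $\overline{\mathbb B}^N$). Then $$\limsup_{|x|\to1}\ \mathcal H_N\big(T_x\circ\omega(\overline{\mathbb B}^N)\big)\ \le\ \mathcal H_N(\mathbb S^N),$$ where $\mathcal H_N$ is $N$-dimensional Hausdorff measure (normalized to agree with Lebesgue measure on $\mathbb R^N$), $\mathbb S^N$ is the unit sphere of $\mathbb R^{N+1}$, and the limsup is over all $x$ in the open unit ball of $\mathbb R^{M+1}$ with $|x|$ tending to $1$. -/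

import Mathlib

open MeasureTheory Filter Topology
open scoped ContDiff

/-- The Möbius transformation
`T_x(y) = ((1 + 2 x·y + |y|²) x + (1 - |x|²) y) / (1 + 2 x·y + |x|² |y|²)` of the closed unit
ball of `ℝᵐ`. The denominator is positive for `|x| < 1` and `|y| ≤ 1`, the only values for
which it is used. -/
noncomputable def moebius {m : ℕ} (x y : EuclideanSpace ℝ (Fin m)) : EuclideanSpace ℝ (Fin m) :=
  (1 + 2 * inner ℝ x y + ‖x‖ ^ 2 * ‖y‖ ^ 2)⁻¹ •
    ((1 + 2 * inner ℝ x y + ‖y‖ ^ 2) • x + (1 - ‖x‖ ^ 2) • y)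

/-- `w` restricts to a smooth embedding of the closed unit ball of `ℝᴺ` (a manifold with boundary)
into the unit sphere of `ℝᴹ⁺¹`: it is smooth up to the boundary, injective on the ball, and an
immersion at every point of the ball. As the ball is compact, it is then automatically a
homeomorphism onto its image. The values of `w` outside the ball play no role. -/
structure IsSmoothBallEmbedding {N M : ℕ}
    (w : EuclideanSpace ℝ (Fin N) → EuclideanSpace ℝ (Fin (M + 1))) : Prop where
  mapsTo : Set.MapsTo w (Metric.closedBall 0 1) (Metric.sphere 0 1)
  contDiffOn : ContDiffOn ℝ ∞ w (Metric.closedBall 0 1)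
  injOn : Set.InjOn w (Metric.closedBall 0 1)
  immersion : ∀ z ∈ Metric.closedBall (0 : EuclideanSpace ℝ (Fin N)) 1,
    Function.Injective (fderivWithin ℝ w (Metric.closedBall 0 1) z)

/-! On the unit sphere, `T_x` is a translate of the inversion centred at `-x`, so it scales
distances by `(1 - |x|²) / (|y + x| |y' + x|)` (`dist_moebius`). As `x → -s` with `|s| = 1`, the
image away from `s` therefore shrinks to zero area. Near `s` the embedding is flat up to a factor `k
> 1`: it can be projected to an `N`-plane. Rescaling that plane by `1 / (1 - |x|)` and applying
inverse stereographic projection lands in `S^N`, and `T_x ∘ w` is Lipschitz with constant `k / |x| ≤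
k²` relative to this map (`dist_moebius_le_rescaledStereo`). The near part thus has area at most
`k^(2N)` times that of `S^N`. Compactness of the sphere makes this uniform in `s`; finally `k → 1`.
-/

open EuclideanGeometry
open scoped NNReal ENNReal

/-! ### Hausdorff measure under Lipschitz comparison. -/

section Hausdorff

variable {X Y Z : Type*} [MetricSpace Y] [MeasurableSpace Y] [BorelSpace Y]
  [MetricSpace Z] [MeasurableSpace Z] [BorelSpace Z]

theorem LipschitzOnWith.euclideanHausdorffMeasure_image_le {f : Y → Z} {s : Set Y} {K : ℝ≥0}
    (hf : LipschitzOnWith K f s) (d : ℕ) : μHE[d] (f '' s) ≤ (K : ℝ≥0∞) ^ d * μHE[d] s := by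
  have h := hf.hausdorffMeasure_image_le (d := d) d.cast_nonneg
  rw [ENNReal.rpow_natCast] at h
  simp only [Measure.euclideanHausdorffMeasure_def, Measure.smul_apply]
  rw [ENNReal.smul_def, ENNReal.smul_def, smul_eq_mul, smul_eq_mul, mul_left_comm]
  gcongr

/-- If `f` is Lipschitz with respect to the pseudometric pulled back by `g`, then the image of `f`
is controlled by the image of `g`. -/
theorem euclideanHausdorffMeasure_image_le_of_dist_le {f : X → Z} {g : X → Y} {s : Set X} {K : ℝ≥0}
    (h : ∀ a ∈ s, ∀ b ∈ s, dist (f a) (f b) ≤ K * dist (g a) (g b)) (d : ℕ) :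
    μHE[d] (f '' s) ≤ (K : ℝ≥0∞) ^ d * μHE[d] (g '' s) := by
  rcases s.eq_empty_or_nonempty with rfl | ⟨a₀, -⟩
  · simp
  have : Nonempty X := ⟨a₀⟩
  have hinv : ∀ a ∈ s, Function.invFunOn g s (g a) ∈ s ∧ g (Function.invFunOn g s (g a)) = g a :=
    fun a ha => ⟨Function.invFunOn_mem ⟨a, ha, rfl⟩, Function.invFunOn_eq ⟨a, ha, rfl⟩⟩
  -- The bound makes `f` constant on the fibres of `g`, so `f` factors through `g` whichever
  -- preimages are chosen.
  have hL : LipschitzOnWith K (f ∘ Function.invFunOn g s) (g '' s) := by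
    refine LipschitzOnWith.of_dist_le_mul ?_
    rintro _ ⟨a, ha, rfl⟩ _ ⟨b, hb, rfl⟩
    have := h _ (hinv a ha).1 _ (hinv b hb).1
    rwa [(hinv a ha).2, (hinv b hb).2] at this
  have himg : f '' s = (f ∘ Function.invFunOn g s) '' (g '' s) := by
    rw [Set.image_image]
    refine Set.image_congr fun a ha => ?_
    have := h _ ha _ (hinv a ha).1
    rw [(hinv a ha).2, dist_self, mul_zero] at this
    exact dist_le_zero.1 this
  rw [himg]
  exact hL.euclideanHausdorffMeasure_image_le d

end Hausdorff

/-! ### Möbius transformations as inversions. -/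

section Moebius

variable {m : ℕ} {x y y' : EuclideanSpace ℝ (Fin m)}

theorem moebius_eq_inversion (hx : ‖x‖ < 1) (hy : ‖y‖ = 1) :
    moebius x y = (2 : ℝ) • x + inversion (-x) (√(1 - ‖x‖ ^ 2)) y := by
  have hpos : 0 ≤ 1 - ‖x‖ ^ 2 := by nlinarith [norm_nonneg x]
  have hne : y + x ≠ 0 := fun h => by
    rw [eq_neg_of_add_eq_zero_left h, norm_neg] at hy
    exact hx.ne hy
  have hn : ‖y + x‖ ^ 2 = 1 + 2 * inner ℝ x y + ‖x‖ ^ 2 := by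
    rw [norm_add_sq_real, hy, real_inner_comm]; ring
  have hn0 : 1 + 2 * inner ℝ x y + ‖x‖ ^ 2 ≠ 0 := by
    rw [← hn]; exact pow_ne_zero _ (norm_ne_zero_iff.2 hne)
  rw [moebius, inversion, dist_eq_norm, sub_neg_eq_add, div_pow, Real.sq_sqrt hpos, hn, hy]
  simp only [vsub_eq_sub, vadd_eq_add, sub_neg_eq_add, one_pow, mul_one]
  rw [div_eq_inv_mul, mul_smul]
  have h2 : (2 : ℝ) • x + ((1 + 2 * inner ℝ x y + ‖x‖ ^ 2)⁻¹ • (1 - ‖x‖ ^ 2) • (y + x) + -x)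
      = x + (1 + 2 * inner ℝ x y + ‖x‖ ^ 2)⁻¹ • (1 - ‖x‖ ^ 2) • (y + x) := by module
  rw [h2, inv_smul_eq_iff₀ hn0, smul_add, smul_inv_smul₀ hn0]
  module

theorem dist_moebius (hx : ‖x‖ < 1) (hy : ‖y‖ = 1) (hy' : ‖y'‖ = 1) :
    dist (moebius x y) (moebius x y') =
      (1 - ‖x‖ ^ 2) / (dist y (-x) * dist y' (-x)) * dist y y' := by
  have hne : ∀ z : EuclideanSpace ℝ (Fin m), ‖z‖ = 1 → z ≠ -x := by
    rintro _ hz rfl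
    rw [norm_neg] at hz
    exact hx.ne hz
  rw [moebius_eq_inversion hx hy, moebius_eq_inversion hx hy', dist_add_left,
    dist_inversion_inversion (hne _ hy) (hne _ hy'),
    Real.sq_sqrt (by nlinarith [norm_nonneg x])]

/-- The two sides differ by exactly `(1 - |x|)³`. The left side has the form `1 + |u|²`, up to
scale, of a squared distance from a hyperplane to the stereographic pole. -/
theorem norm_mul_le_dist_neg_sq {E : Type*} [NormedAddCommGroup E] [InnerProductSpace ℝ E] {x y : E}
    (hx0 : 0 < ‖x‖) (hx : ‖x‖ < 1) (hy : ‖y‖ = 1) :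
    ‖x‖ * ((1 - ‖x‖) ^ 2 + ‖y + ‖x‖⁻¹ • x‖ ^ 2) ≤ dist y (-x) ^ 2 := by
  rw [dist_eq_norm, sub_neg_eq_add, norm_add_sq_real, norm_add_sq_real, inner_smul_right, norm_smul,
    norm_inv, norm_norm, inv_mul_cancel₀ hx0.ne', hy]
  have : ‖x‖ * (‖x‖⁻¹ * inner ℝ y x) = inner ℝ y x := mul_inv_cancel_left₀ hx0.ne' _
  nlinarith [sq_nonneg (1 - ‖x‖)]

end Moebius

/-! ### Comparison with inverse stereographic projection. -/

section Stereographic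

variable {F : Type*} [NormedAddCommGroup F] [InnerProductSpace ℝ F] {v u : F}

theorem dist_unit_sq_of_inner_eq_zero (hv : ‖v‖ = 1) (huv : inner ℝ u v = 0) :
    dist u v ^ 2 = 1 + ‖u‖ ^ 2 := by
  rw [dist_eq_norm, norm_sub_sq_real, huv, hv]; ring

/-- This inversion is inverse stereographic projection from `v`. -/
theorem norm_inversion_sqrt_two (hv : ‖v‖ = 1) (huv : inner ℝ u v = 0) :
    ‖inversion v (√2) u‖ = 1 := by
  have hd := dist_unit_sq_of_inner_eq_zero hv huv
  have hd0 : dist u v ^ 2 ≠ 0 := by rw [hd]; positivity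
  have hin : inner ℝ (u - v) v = -1 := by
    rw [inner_sub_left, huv, real_inner_self_eq_norm_sq, hv]; norm_num
  have : ‖inversion v (√2) u‖ ^ 2 = 1 := by
    rw [inversion, div_pow, Real.sq_sqrt (by norm_num), vadd_eq_add, vsub_eq_sub,
      norm_add_sq_real, norm_smul, inner_smul_left, hin, mul_pow, hv, ← dist_eq_norm]
    simp only [Real.norm_eq_abs, sq_abs, conj_trivial]
    field_simp
    ring
  nlinarith [norm_nonneg (inversion v (√2) u)]

variable {E : Type*} [NormedAddCommGroup E] [InnerProductSpace ℝ E]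

/-- The contraction `π` onto the hyperplane orthogonal to `v`, rescaled around the projection of
`-x / |x|` with scale `1 - |x|` and followed by inverse stereographic projection from `v`. -/
noncomputable def rescaledStereo (v : F) (π : E →L[ℝ] F) (x y : E) : F :=
  inversion v (√2) ((1 - ‖x‖)⁻¹ • π (y + ‖x‖⁻¹ • x))

theorem norm_rescaledStereo (hv : ‖v‖ = 1) {π : E →L[ℝ] F} (hπ : ∀ y, inner ℝ (π y) v = 0)
    (x y : E) :
    ‖rescaledStereo v π x y‖ = 1 :=
  norm_inversion_sqrt_two hv (by rw [inner_smul_left, hπ, mul_zero])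

/-- Both distances come from the inversion formula. Since `π` contracts, each denominator for `T_x`
is at least `√|x| (1 - |x|)` times the stereographic one; the numerator `(1 - |x|)(1 + |x|)` is
matched using `1 + |x| ≤ 2 = (√2)²`. -/
theorem dist_moebius_le_rescaledStereo {m : ℕ} {x y y' : EuclideanSpace ℝ (Fin m)}
    {π : EuclideanSpace ℝ (Fin m) →L[ℝ] F} (hv : ‖v‖ = 1) (hπ : ∀ y, inner ℝ (π y) v = 0)
    (hπ1 : ∀ y, ‖π y‖ ≤ ‖y‖) (hx0 : 0 < ‖x‖) (hx : ‖x‖ < 1) (hy : ‖y‖ = 1) (hy' : ‖y'‖ = 1)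
    {k : ℝ} (hk : 0 ≤ k) (h : dist y y' ≤ k * dist (π y) (π y')) :
    dist (moebius x y) (moebius x y') ≤
      k / ‖x‖ * dist (rescaledStereo v π x y) (rescaledStereo v π x y') := by
  have ht : 0 < 1 - ‖x‖ := sub_pos.2 hx
  set u : EuclideanSpace ℝ (Fin m) → F := fun y => (1 - ‖x‖)⁻¹ • π (y + ‖x‖⁻¹ • x) with hu
  have hu0 : ∀ y, inner ℝ (u y) v = 0 := fun y => by
    rw [hu]; simp only; rw [inner_smul_left, hπ, mul_zero]
  have hD : ∀ y, 0 < dist (u y) v := fun y => by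
    have := dist_unit_sq_of_inner_eq_zero hv (hu0 y)
    exact lt_of_le_of_ne dist_nonneg fun h0 => by
      rw [← h0] at this; nlinarith [sq_nonneg ‖u y‖]
  have hlow : ∀ y, ‖y‖ = 1 → √‖x‖ * (1 - ‖x‖) * dist (u y) v ≤ dist y (-x) := fun y hy => by
    refine abs_le_of_sq_le_sq' ?_ dist_nonneg |>.2
    refine le_trans ?_ (norm_mul_le_dist_neg_sq hx0 hx hy)
    rw [mul_pow, mul_pow, Real.sq_sqrt hx0.le, dist_unit_sq_of_inner_eq_zero hv (hu0 y), mul_assoc]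
    refine mul_le_mul_of_nonneg_left ?_ hx0.le
    have : ‖u y‖ = (1 - ‖x‖)⁻¹ * ‖π (y + ‖x‖⁻¹ • x)‖ := by
      rw [hu]; simp only; rw [norm_smul, norm_inv, Real.norm_of_nonneg ht.le]
    rw [this, mul_add, mul_one, ← mul_pow, mul_inv_cancel_left₀ ht.ne']
    gcongr
    exact hπ1 _
  have hdist : dist (rescaledStereo v π x y) (rescaledStereo v π x y') =
      2 / (dist (u y) v * dist (u y') v) * ((1 - ‖x‖)⁻¹ * dist (π y) (π y')) := by
    have hne : ∀ y, u y ≠ v := fun y => dist_pos.1 (hD y)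
    have := dist_inversion_inversion (hne y) (hne y') (√2)
    rw [Real.sq_sqrt (by norm_num)] at this
    rw [rescaledStereo, rescaledStereo, this, hu]
    simp only
    rw [dist_smul₀, map_add, map_add, dist_add_right, norm_inv, Real.norm_of_nonneg ht.le]
  have hs : 0 < √‖x‖ := Real.sqrt_pos.2 hx0
  have hDy := hD y
  have hDy' := hD y'
  rw [dist_moebius hx hy hy', hdist]
  calc (1 - ‖x‖ ^ 2) / (dist y (-x) * dist y' (-x)) * dist y y'
      ≤ (1 - ‖x‖ ^ 2) / ((√‖x‖ * (1 - ‖x‖) * dist (u y) v) * (√‖x‖ * (1 - ‖x‖) * dist (u y') v))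
        * (k * dist (π y) (π y')) := by
        have : 0 ≤ 1 - ‖x‖ ^ 2 := by nlinarith
        gcongr
        · exact hlow y hy
        · exact hlow y' hy'
    _ = (1 + ‖x‖) * (k / ‖x‖ * (1 / (dist (u y) v * dist (u y') v)
        * ((1 - ‖x‖)⁻¹ * dist (π y) (π y')))) := by
        have h2 : √‖x‖ * (1 - ‖x‖) * dist (u y) v * (√‖x‖ * (1 - ‖x‖) * dist (u y') v) =
          ‖x‖ * (1 - ‖x‖) ^ 2 * (dist (u y) v * dist (u y') v) := by
          linear_combination (1 - ‖x‖) ^ 2 * (dist (u y) v * dist (u y') v) * Real.sq_sqrt hx0.le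
        rw [h2]
        field_simp
        ring
    _ ≤ 2 * (k / ‖x‖ * (1 / (dist (u y) v * dist (u y') v)
        * ((1 - ‖x‖)⁻¹ * dist (π y) (π y')))) := by
        gcongr
        linarith
    _ = _ := by ring

end Stereographic

/-! ### Almost isometric projection of an immersion. -/

section Immersion

variable {E G H : Type*} [NormedAddCommGroup E] [InnerProductSpace ℝ E] [FiniteDimensional ℝ E]
  [NormedAddCommGroup G] [InnerProductSpace ℝ G]
  [NormedAddCommGroup H] [InnerProductSpace ℝ H] [FiniteDimensional ℝ H]

/-- A linear injection into `G` is an isometry after composing with a contraction of `G` onto a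
space of the same dimension as the source. -/
theorem exists_contraction_norm_comp_eq (L : E →L[ℝ] G) (hL : Function.Injective L)
    (hEH : Module.finrank ℝ E = Module.finrank ℝ H) :
    ∃ π : G →L[ℝ] H, (∀ y, ‖π y‖ ≤ ‖y‖) ∧ ∀ z, ‖π (L z)‖ = ‖L z‖ := by
  set R : Submodule ℝ G := L.toLinearMap.range
  have hR : Module.finrank ℝ R = Module.finrank ℝ H := by
    rw [← hEH]; exact LinearMap.finrank_range_of_inj hL
  let e : R ≃ₗᵢ[ℝ] H := 
    (stdOrthonormalBasis ℝ R).equiv (stdOrthonormalBasis ℝ H) (finCongr hR)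
  refine ⟨(e.toContinuousLinearEquiv : R →L[ℝ] H).comp R.orthogonalProjectionOnto,
    fun y => ?_, fun z => ?_⟩
  · exact (e.norm_map _).trans_le (R.norm_orthogonalProjectionOnto_apply_le y)
  · refine (e.norm_map _).trans ?_
    have := R.orthogonalProjectionOnto_mem_subspace_eq_self ⟨L z, LinearMap.mem_range_self _ z⟩
    exact congrArg norm this

/-- Near a point of a convex set at which a `C¹` map is an immersion, distances in the image are
almost preserved by a linear contraction onto a space of the dimension of the source. -/
theorem exists_contraction_dist_le {f : E → G} {s : Set E} (hs : Convex ℝ s)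
    (hsu : UniqueDiffOn ℝ s) (hf : ContDiffOn ℝ 1 f s) {z₀ : E} (hz₀ : z₀ ∈ s)
    (hinj : Function.Injective (fderivWithin ℝ f s z₀))
    (hEH : Module.finrank ℝ E = Module.finrank ℝ H) {k : ℝ} (hk : 1 < k) :
    ∃ ρ > 0, ∃ π : G →L[ℝ] H, (∀ y, ‖π y‖ ≤ ‖y‖) ∧
      ∀ a ∈ s ∩ Metric.ball z₀ ρ, ∀ b ∈ s ∩ Metric.ball z₀ ρ,
        dist (f a) (f b) ≤ k * dist (π (f a)) (π (f b)) := by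
  set L := fderivWithin ℝ f s z₀ with hLdef
  obtain ⟨K, hK, hKL⟩ := (L.toLinearMap.injective_iff_antilipschitz).1 hinj
  obtain ⟨π, hπ, hπL⟩ := exists_contraction_norm_comp_eq (H := H) L hinj hEH
  have hK' : (0 : ℝ) < K := hK
  have hKbd : ∀ z, ‖z‖ ≤ K * ‖L z‖ := fun z => by
    simpa using hKL.le_mul_dist z 0
  -- Chosen so that the error satisfies `|e| ≤ (k - 1)/(k + 1) |L(a - b)|`, which is equivalent to
  -- `|L(a - b)| + |e| ≤ k (|L(a - b)| - |e|)`.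
  set δ : ℝ := (k - 1) / (K * (k + 1)) with hδ
  have hδ0 : 0 < δ := by have : 0 < k - 1 := by linarith
                         positivity
  have hcont : ContinuousOn (fderivWithin ℝ f s) s := hf.continuousOn_fderivWithin hsu le_rfl
  obtain ⟨ρ, hρ, hball⟩ := Metric.continuousWithinAt_iff.1 (hcont z₀ hz₀) δ hδ0
  refine ⟨ρ, hρ, π, hπ, fun a ha b hb => ?_⟩
  have key : ‖f a - f b - L (a - b)‖ ≤ δ * ‖a - b‖ := by
    refine (hs.inter (convex_ball z₀ ρ)).norm_image_sub_le_of_norm_hasFDerivWithin_le'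
      (f' := fderivWithin ℝ f s) (fun z hz => ?_) (fun z hz => ?_) hb ha
    · exact ((hf.differentiableOn one_ne_zero) z hz.1).hasFDerivWithinAt.mono Set.inter_subset_left
    · rw [← dist_eq_norm]
      exact (hball hz.1 hz.2).le
  set e := f a - f b - L (a - b) with he
  have hsplit : f a - f b = L (a - b) + e := by rw [he]; abel
  have he1 : ‖e‖ ≤ (k - 1) / (k + 1) * ‖L (a - b)‖ := by
    calc ‖e‖ ≤ δ * (K * ‖L (a - b)‖) := key.trans (by gcongr; exact hKbd _)
      _ = _ := by rw [hδ]; field_simp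
  have hup : ‖f a - f b‖ ≤ ‖L (a - b)‖ + ‖e‖ := by rw [hsplit]; exact norm_add_le _ _
  have hlow : ‖L (a - b)‖ - ‖e‖ ≤ ‖π (f a) - π (f b)‖ := by
    rw [← map_sub, hsplit, map_add, ← hπL]
    have h1 := norm_sub_le (π (L (a - b)) + π e) (π e)
    rw [add_sub_cancel_right] at h1
    linarith [hπ e]
  rw [dist_eq_norm, dist_eq_norm]
  have : (k + 1) * ‖e‖ ≤ (k - 1) * ‖L (a - b)‖ := by
    have h0 : (0 : ℝ) < k + 1 := by linarith
    calc (k + 1) * ‖e‖ ≤ (k + 1) * ((k - 1) / (k + 1) * ‖L (a - b)‖) := by gcongr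
      _ = _ := by field_simp
  nlinarith [mul_le_mul_of_nonneg_left hlow (by linarith : 0 ≤ k)]

end Immersion

/-! ### Area estimates near and away from the pole. -/

namespace IsSmoothBallEmbedding

variable {N M : ℕ} {w : EuclideanSpace ℝ (Fin N) → EuclideanSpace ℝ (Fin (M + 1))}

/-- Injectivity and compactness turn a neighbourhood in the source into the full preimage of a small
ball about `s`, so no other sheet of the image comes close. -/
theorem exists_contraction_dist_le {H : Type*} [NormedAddCommGroup H] [InnerProductSpace ℝ H]
    [FiniteDimensional ℝ H] (hw : IsSmoothBallEmbedding w) (hH : Module.finrank ℝ H = N)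
    (s : EuclideanSpace ℝ (Fin (M + 1))) {k : ℝ} (hk : 1 < k) :
    ∃ r > 0, ∃ π : EuclideanSpace ℝ (Fin (M + 1)) →L[ℝ] H, (∀ y, ‖π y‖ ≤ ‖y‖) ∧
      ∀ a ∈ Metric.closedBall 0 1 ∩ w ⁻¹' Metric.ball s r,
        ∀ b ∈ Metric.closedBall 0 1 ∩ w ⁻¹' Metric.ball s r,
          dist (w a) (w b) ≤ k * dist (π (w a)) (π (w b)) := by
  have hcont : ContinuousOn w (Metric.closedBall 0 1) := hw.contDiffOn.continuousOn
  have hsep : ∀ C : Set (EuclideanSpace ℝ (Fin N)), IsCompact C → C ⊆ Metric.closedBall 0 1 →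
      s ∉ w '' C → ∃ r > 0, Disjoint C (w ⁻¹' Metric.ball s r) := fun C hC hCB hsC => by
    have hcl : IsClosed (w '' C) := (hC.image_of_continuousOn (hcont.mono hCB)).isClosed
    obtain ⟨r, hr, hr'⟩ := Metric.isOpen_iff.1 hcl.isOpen_compl s hsC
    exact ⟨r, hr, Set.disjoint_left.2 fun a ha ha' => hr' ha' ⟨a, ha, rfl⟩⟩
  by_cases hs : s ∈ w '' Metric.closedBall 0 1
  · obtain ⟨z₀, hz₀, rfl⟩ := hs
    have hu : UniqueDiffOn ℝ (Metric.closedBall (0 : EuclideanSpace ℝ (Fin N)) 1) :=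
      uniqueDiffOn_convex (convex_closedBall _ _)
        (by rw [interior_closedBall _ one_ne_zero]; exact ⟨0, by simp⟩)
    obtain ⟨ρ, hρ, π, hπ, h⟩ := _root_.exists_contraction_dist_le (H := H)
      (convex_closedBall (0 : EuclideanSpace ℝ (Fin N)) 1) hu (hw.contDiffOn.of_le (by norm_cast))
      hz₀ (hw.immersion z₀ hz₀) (by rw [hH, finrank_euclideanSpace_fin]) hk
    obtain ⟨r, hr, hdisj⟩ := hsep (Metric.closedBall 0 1 \ Metric.ball z₀ ρ)
      ((isCompact_closedBall _ _).diff Metric.isOpen_ball) Set.sdiff_subset (by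
        rintro ⟨a, ⟨ha, hab⟩, hwa⟩
        rw [hw.injOn ha hz₀ hwa] at hab
        exact hab (Metric.mem_ball_self hρ))
    have hmem : ∀ a ∈ Metric.closedBall 0 1 ∩ w ⁻¹' Metric.ball (w z₀) r,
        a ∈ Metric.closedBall 0 1 ∩ Metric.ball z₀ ρ := fun a ha =>
      ⟨ha.1, by_contra fun hn => Set.disjoint_left.1 hdisj ⟨ha.1, hn⟩ ha.2⟩
    exact ⟨r, hr, π, hπ, fun a ha b hb => h a (hmem a ha) b (hmem b hb)⟩
  · obtain ⟨r, hr, hdisj⟩ := hsep _ (isCompact_closedBall _ _) le_rfl hs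
    exact ⟨r, hr, 0, by simp, fun a ha => (Set.disjoint_left.1 hdisj ha.1 ha.2).elim⟩

theorem euclideanHausdorffMeasure_image_ne_top (hw : IsSmoothBallEmbedding w) :
    μHE[N] (w '' Metric.closedBall 0 1) ≠ ⊤ := by
  obtain ⟨K, hK⟩ := hw.contDiffOn.exists_lipschitzOnWith (by simp) (convex_closedBall _ _)
    (isCompact_closedBall _ _)
  refine ne_top_of_le_ne_top ?_ (hK.euclideanHausdorffMeasure_image_le N)
  rw [EuclideanSpace.euclideanHausdorffMeasure_eq_volume]
  exact ENNReal.mul_ne_top (by simp) measure_closedBall_lt_top.ne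

theorem norm_eq_one (hw : IsSmoothBallEmbedding w) {z : EuclideanSpace ℝ (Fin N)}
    (hz : z ∈ Metric.closedBall 0 1) : ‖w z‖ = 1 :=
  mem_sphere_zero_iff_norm.1 (hw.mapsTo hz)

/-- The part of the image near `s` stays almost below the unit sphere in area as `x → -s`. -/
theorem euclideanHausdorffMeasure_moebius_near_le (hw : IsSmoothBallEmbedding w)
    (s : EuclideanSpace ℝ (Fin (M + 1))) {k : ℝ≥0} (hk : 1 < k) :
    ∃ r > 0, ∀ x : EuclideanSpace ℝ (Fin (M + 1)), (k : ℝ)⁻¹ ≤ ‖x‖ → ‖x‖ < 1 →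
      μHE[N] ((moebius x ∘ w) '' (Metric.closedBall 0 1 ∩ w ⁻¹' Metric.ball s r)) ≤
        ((k * k : ℝ≥0) : ℝ≥0∞) ^ N *
          μHE[N] (Metric.sphere (0 : EuclideanSpace ℝ (Fin (N + 1))) 1) := by
  set v : EuclideanSpace ℝ (Fin (N + 1)) := EuclideanSpace.single 0 1
  have hv : ‖v‖ = 1 := by simp [v]
  have hv0 : v ≠ 0 := by rw [← norm_ne_zero_iff, hv]; exact one_ne_zero
  have hfin : Module.finrank ℝ (ℝ ∙ v)ᗮ = N :=
    have : Fact (Module.finrank ℝ (EuclideanSpace ℝ (Fin (N + 1))) = N + 1) :=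
      ⟨finrank_euclideanSpace_fin⟩
    Submodule.finrank_orthogonal_span_singleton hv0
  obtain ⟨r, hr, π, hπ, h⟩ := hw.exists_contraction_dist_le hfin s (k := k) (mod_cast hk)
  refine ⟨r, hr, fun x hkx hx => ?_⟩
  have hk0 : (0 : ℝ) < k := zero_lt_one.trans (mod_cast hk)
  have hx0 : 0 < ‖x‖ := (inv_pos.2 hk0).trans_le hkx
  set π' := (ℝ ∙ v)ᗮ.subtypeL.comp π
  have hπv : ∀ y, inner ℝ (π' y) v = 0 := fun y =>
    Submodule.mem_orthogonal_singleton_iff_inner_left.1 (π y).2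
  refine (euclideanHausdorffMeasure_image_le_of_dist_le (K := k * k)
    (g := fun z => rescaledStereo v π' x (w z)) (fun a ha b hb => ?_) N).trans ?_
  · refine (dist_moebius_le_rescaledStereo hv hπv hπ hx0 hx (hw.norm_eq_one ha.1)
      (hw.norm_eq_one hb.1) hk0.le (h a ha b hb)).trans ?_
    rw [NNReal.coe_mul, div_eq_mul_inv]
    gcongr
    exact inv_le_of_inv_le₀ hk0 hkx
  · gcongr
    rintro _ ⟨z, -, rfl⟩
    rw [mem_sphere_zero_iff_norm]
    exact norm_rescaledStereo hv hπv _ _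

/-- The part of the image away from `s` has area tending to zero as `x → -s`. -/
theorem eventually_euclideanHausdorffMeasure_moebius_far_le (hw : IsSmoothBallEmbedding w)
    (hN : N ≠ 0) {s : EuclideanSpace ℝ (Fin (M + 1))} (hs : ‖s‖ = 1) {r : ℝ} (hr : 0 < r)
    {ε : ℝ≥0∞} (hε : 0 < ε) :
    ∀ᶠ x in 𝓝 (-s), ‖x‖ < 1 →
      μHE[N] ((moebius x ∘ w) '' (Metric.closedBall 0 1 \ w ⁻¹' Metric.ball s r)) ≤ ε := by
  -- For `|x + s| < r/2`, points at distance at least `r` from `s` stay at least `r/2` from the pole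
  -- `-x`.
  set c : EuclideanSpace ℝ (Fin (M + 1)) → ℝ := fun x => (1 - ‖x‖ ^ 2) / (r / 2 * (r / 2)) with hc
  have hbound : ∀ x ∈ Metric.ball (-s) (r / 2), ‖x‖ < 1 →
      μHE[N] ((moebius x ∘ w) '' (Metric.closedBall 0 1 \ w ⁻¹' Metric.ball s r)) ≤
        (ENNReal.ofReal (c x)) ^ N * μHE[N] (w '' Metric.closedBall 0 1) := fun x hxs hx => by
    have hx2 : 0 ≤ 1 - ‖x‖ ^ 2 := by nlinarith [norm_nonneg x]
    have hfar : ∀ a ∈ Metric.closedBall 0 1 \ w ⁻¹' Metric.ball s r, r / 2 ≤ dist (w a) (-x) :=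
      fun a ha => by
        have h1 : r ≤ dist (w a) s := not_lt.1 ha.2
        have h2 : dist (-x) s < r / 2 := by rw [← dist_neg_neg, neg_neg]; exact hxs
        linarith [dist_triangle (w a) (-x) s]
    refine (euclideanHausdorffMeasure_image_le_of_dist_le (K := (c x).toNNReal) (g := w)
      (fun a ha b hb => ?_) N).trans ?_
    · rw [Real.coe_toNNReal _ (by positivity)]
      simp only [Function.comp_apply]
      rw [dist_moebius hx (hw.norm_eq_one ha.1) (hw.norm_eq_one hb.1)]
      refine mul_le_mul_of_nonneg_right ?_ dist_nonneg
      simp only [hc]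
      gcongr
      · exact hfar a ha
      · exact hfar b hb
    · gcongr
      · exact le_rfl
      · exact Set.sdiff_subset
  have hlim : Tendsto (fun x => (ENNReal.ofReal (c x)) ^ N * μHE[N] (w '' Metric.closedBall 0 1))
      (𝓝 (-s)) (𝓝 0) := by
    have hc0 : Tendsto c (𝓝 (-s)) (𝓝 0) := by
      have : Continuous c := by fun_prop
      simpa [hc, hs] using this.tendsto (-s)
    have h1 := ENNReal.Tendsto.pow (n := N) (ENNReal.tendsto_ofReal hc0)
    rw [ENNReal.ofReal_zero, zero_pow hN] at h1
    simpa using ENNReal.Tendsto.mul_const h1 (Or.inr hw.euclideanHausdorffMeasure_image_ne_top)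
  filter_upwards [Metric.ball_mem_nhds (-s) (half_pos hr), hlim.eventually_le_const hε]
    with x hxs hxε hx using (hbound x hxs hx).trans hxε

theorem eventually_euclideanHausdorffMeasure_moebius_le (hw : IsSmoothBallEmbedding w)
    (hN : N ≠ 0) {k : ℝ≥0} (hk : 1 < k) {ε : ℝ≥0∞} (hε : 0 < ε) :
    ∀ᶠ x : EuclideanSpace ℝ (Fin (M + 1)) in comap (fun x => ‖x‖) (𝓝[<] (1 : ℝ)),
      μHE[N] ((moebius x ∘ w) '' Metric.closedBall (0 : EuclideanSpace ℝ (Fin N)) 1) ≤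
        ((k * k : ℝ≥0) : ℝ≥0∞) ^ N *
          μHE[N] (Metric.sphere (0 : EuclideanSpace ℝ (Fin (N + 1))) 1) + ε := by
  have hlocal : ∀ s ∈ Metric.sphere (0 : EuclideanSpace ℝ (Fin (M + 1))) 1,
      ∀ᶠ x in 𝓝 s, ‖x‖ < 1 →
        μHE[N] ((moebius x ∘ w) '' Metric.closedBall (0 : EuclideanSpace ℝ (Fin N)) 1) ≤
        ((k * k : ℝ≥0) : ℝ≥0∞) ^ N *
          μHE[N] (Metric.sphere (0 : EuclideanSpace ℝ (Fin (N + 1))) 1) + ε := fun s hs => by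
    rw [mem_sphere_zero_iff_norm] at hs
    -- As `x → s` the pole `-x` tends to `-s`, so the image is split there.
    obtain ⟨r, hr, hnear⟩ := hw.euclideanHausdorffMeasure_moebius_near_le (-s) hk
    have hfar := hw.eventually_euclideanHausdorffMeasure_moebius_far_le hN
      (s := -s) (by rwa [norm_neg]) hr hε
    rw [neg_neg] at hfar
    have hk1 : (k : ℝ)⁻¹ < ‖s‖ := by rw [hs]; exact inv_lt_one_of_one_lt₀ (mod_cast hk)
    filter_upwards [hfar, continuous_norm.continuousAt.eventually_const_lt hk1] with x hx hkx hx1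
    rw [← Set.inter_union_sdiff (Metric.closedBall 0 1) (w ⁻¹' Metric.ball (-s) r), Set.image_union]
    exact (measure_union_le _ _).trans (add_le_add (hnear x hkx.le hx1) (hx hx1))
  have hset := mem_nhdsSet_iff_forall.2 hlocal
  obtain ⟨U, hUo, hsU, hU⟩ := mem_nhdsSet_iff_exists.1 hset
  have hcomap : U ∈ comap (fun x : EuclideanSpace ℝ (Fin (M + 1)) => ‖x‖) (𝓝 1) := by
    obtain ⟨δ, hδ, hδU⟩ := (isCompact_sphere _ _).exists_thickening_subset_open hUo hsU
    -- The radial projection `x / |x|` is at distance `||x| - 1|` from `x`; the bound by `1` keeps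
    -- `x` nonzero.
    refine mem_comap.2 ⟨Metric.ball 1 (min δ 1), Metric.ball_mem_nhds _ (by positivity),
      fun x hx => ?_⟩
    refine hδU (Metric.mem_thickening_iff.2 ⟨‖x‖⁻¹ • x, ?_, ?_⟩)
    all_goals
      have hx' : |‖x‖ - 1| < min δ 1 := hx
      have hx0 : 0 < ‖x‖ := by linarith [(abs_lt.1 (hx'.trans_le (min_le_right _ _))).1]
    · rw [mem_sphere_zero_iff_norm, norm_smul, norm_inv, norm_norm, inv_mul_cancel₀ hx0.ne']
    · have : x - ‖x‖⁻¹ • x = ((‖x‖ - 1) * ‖x‖⁻¹) • x := by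
        rw [sub_mul, mul_inv_cancel₀ hx0.ne', sub_smul, one_smul, one_mul]
      rw [dist_eq_norm, this, norm_smul, norm_mul, norm_inv, norm_norm, mul_assoc,
        inv_mul_cancel₀ hx0.ne', mul_one]
      exact hx'.trans_le (min_le_left _ _)
  have hlt : ∀ᶠ x : EuclideanSpace ℝ (Fin (M + 1)) in comap (fun x => ‖x‖) (𝓝[<] (1 : ℝ)),
      ‖x‖ < 1 := tendsto_comap.eventually self_mem_nhdsWithin
  filter_upwards [comap_mono nhdsWithin_le_nhds hcomap, hlt] with x hxU hx using hU hxU hx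

end IsSmoothBallEmbedding

theorem mainTheorem7 (N M : ℕ) (hN : 1 ≤ N) (hNM : N ≤ M)
    (w : EuclideanSpace ℝ (Fin N) → EuclideanSpace ℝ (Fin (M + 1)))
    (hw : IsSmoothBallEmbedding w) :
    limsup (fun x : EuclideanSpace ℝ (Fin (M + 1)) =>
        μHE[N] ((moebius x ∘ w) '' Metric.closedBall (0 : EuclideanSpace ℝ (Fin N)) 1))
      (comap (fun x : EuclideanSpace ℝ (Fin (M + 1)) => ‖x‖) (𝓝[<] (1 : ℝ))) ≤
    μHE[N] (Metric.sphere (0 : EuclideanSpace ℝ (Fin (N + 1))) 1) := by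
  set σ := μHE[N] (Metric.sphere (0 : EuclideanSpace ℝ (Fin (N + 1))) 1)
  have hbound : ∀ k : ℝ≥0, 1 < k → limsup (fun x : EuclideanSpace ℝ (Fin (M + 1)) =>
        μHE[N] ((moebius x ∘ w) '' Metric.closedBall (0 : EuclideanSpace ℝ (Fin N)) 1))
      (comap (fun x : EuclideanSpace ℝ (Fin (M + 1)) => ‖x‖) (𝓝[<] (1 : ℝ))) ≤
      ((k * k : ℝ≥0) : ℝ≥0∞) ^ N * σ := fun k hk =>
    ENNReal.le_of_forall_pos_le_add fun ε hε _ => limsup_le_of_le (by isBoundedDefault)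
      (hw.eventually_euclideanHausdorffMeasure_moebius_le (by omega) hk (ENNReal.coe_pos.2 hε))
  have hlim : Tendsto (fun k : ℝ≥0 => ((k * k : ℝ≥0) : ℝ≥0∞) ^ N * σ) (𝓝[>] 1) (𝓝 σ) := by
    have h1 : Tendsto (fun k : ℝ≥0 => ((k * k : ℝ≥0) : ℝ≥0∞)) (𝓝[>] 1) (𝓝 1) := by
      have : Continuous fun k : ℝ≥0 => ((k * k : ℝ≥0) : ℝ≥0∞) :=
        ENNReal.continuous_coe.comp (by fun_prop)
      simpa using (this.tendsto 1).mono_left nhdsWithin_le_nhds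
    have h2 := ENNReal.Tendsto.pow (n := N) h1
    rw [one_pow] at h2
    simpa using ENNReal.Tendsto.mul_const (b := σ) h2 (Or.inl one_ne_zero)
  exact ge_of_tendsto hlim (eventually_nhdsWithin_of_forall hbound)
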